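/- Let $p\ge 1$, $T>0$, $\omega>\Lambda>0$, $z\in(0,1)$, $\varepsilon>0$, $0<\delta<1$, and let $n$ be an integer with $n\ge \frac{\omega T}{\pi\sqrt z}$. Let $\mathbf X(t)$, $t\in\mathbb R$, be a real-valued, centered, stationary Gaussian process, jointly measurable on $[0,T]\times\Omega$ (up to null sets), whose spectrum is bandlimited to $[-\Lambda,\Lambda)$, that is, for some finite measure $F$ concentrated on $[-\Lambda,\Lambda)$, \[\mathbf B(\tau):=\mathbf E\,\mathbf X(t+\tau)\mathbf X(t)=\int_{[-\Lambda,\Lambda)}e^{i\tau\lambda}\,dF(\lambda)\qquad\text{for all } t,\tau\in\mathbb R .\] Put \[\mathbf X_n(t):=\sum_{k=-n}^{n}\frac{\sin\left(\omega\left(t-\frac{k\pi}{\omega}\right)\right)}{\omega\left(t-\frac{k\pi}{\omega}\right)}\,\mathbf X\left(\frac{k\pi}{\omega}\right)\] (the quotient being $1$ at $t=k\pi/\omega$), and \[C_n(t):=\mathbf B(0)\left(\frac{4\omega t}{\pi^2(1-z)}+\frac{4\left(z+1+\frac1n\right)}{\pi(1-z)^2\left(1-\frac{\Lambda}{\omega}\right)}\right)^2,\qquad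 \hat S_{n,p}:=n^{-p}\int_0^T C_n(t)^{p/2}\,dt .\] If \[\hat S_{n,p}<\frac{\varepsilon}{\max\left(p^{p/2},\,(2\ln(2/\delta))^{p/2}\right)},\] then $\mathbf X_n$ approximates $\mathbf X$ in $L_p([0,T])$ with accuracy $\varepsilon$ and reliability $1-\delta$: the integral $\int_0^T|\mathbf X(t)-\mathbf X_n(t)|^p\,dt$ exists with probability $1$, and \[\mathbf P\left\{\int_0^T|\mathbf X(t)-\mathbf X_n(t)|^p\,dt>\varepsilon\right\}\le\delta .\] -/

import Mathlib

open MeasureTheory ProbabilityTheory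

namespace WKS

noncomputable section

/-- Centred second-order stationary real process whose spectrum is bandlimited to `[-L, L)`:
`E X(t+τ) X(t) = ∫_{[-L,L)} exp(iτλ) dF(λ)` for a finite spectral measure `F` carried by
`[-L, L)`. The right-hand side does not depend on `t`, so this contains stationarity. -/
structure IsBandlimitedStationary {Ω : Type*} [MeasurableSpace Ω] (P : Measure Ω)
    (X : ℝ → Ω → ℝ) (L : ℝ) : Prop where
  memLp_two : ∀ t, MemLp (X t) 2 P
  mean_zero : ∀ t, ∫ x, X t x ∂P = 0
  spectrum : ∃ F : Measure ℝ, IsFiniteMeasure F ∧ F (Set.Ico (-L) L)ᶜ = 0 ∧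
    ∀ t τ : ℝ, ((∫ x, X (t + τ) x * X t x ∂P : ℝ) : ℂ) =
      ∫ l in Set.Ico (-L) L, Complex.exp (Complex.I * (τ : ℂ) * (l : ℂ)) ∂F

/-- The covariance function `B(τ) = E X(t+τ) X(t)` of a centred stationary process, taken
at `t = 0`. -/
def covFun {Ω : Type*} [MeasurableSpace Ω] (P : Measure Ω) (X : ℝ → Ω → ℝ) (τ : ℝ) : ℝ :=
  ∫ x, X (0 + τ) x * X 0 x ∂P

/-- The truncated Whittaker-Kotel'nikov-Shannon sum
`X_n(t) = ∑_{k=-n}^{n} sin(ω(t-kπ/ω)) / (ω(t-kπ/ω)) * X(kπ/ω)`;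
`Real.sinc y` is `sin y / y`, with value `1` at `y = 0`. -/
def truncSum {Ω : Type*} (X : ℝ → Ω → ℝ) (ω : ℝ) (n : ℕ) (t : ℝ) (x : Ω) : ℝ :=
  ∑ k ∈ Finset.Icc (-(n : ℤ)) (n : ℤ),
    Real.sinc (ω * (t - (k : ℝ) * Real.pi / ω)) * X ((k : ℝ) * Real.pi / ω) x

/-- The function `C_n(t)`, where `b` stands for `B(0)` and `L` for the band limit. -/
def Cn (b ω L z : ℝ) (n : ℕ) (t : ℝ) : ℝ :=
  b * (4 * ω * t / (Real.pi ^ 2 * (1 - z)) +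
    4 * (z + 1 + 1 / (n : ℝ)) / (Real.pi * (1 - z) ^ 2 * (1 - L / ω))) ^ 2

/-- `Ŝ_{n,p} = n^{-p} ∫_0^T C_n(t)^{p/2} dt`. -/
def Shat (b ω L z : ℝ) (n : ℕ) (p T : ℝ) : ℝ :=
  (n : ℝ) ^ (-p) * ∫ t in (0 : ℝ)..T, (Cn b ω L z n t) ^ (p / 2)

/-- `Y` approximates `X` in `L_p([0,T])` with accuracy `ε` and reliability `1 - δ`:
the integral `∫_0^T |X(t) - Y(t)|^p dt` exists almost surely, and it exceeds `ε` with
probability at most `δ`. -/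
def ApproximatesLp {Ω : Type*} [MeasurableSpace Ω] (P : Measure Ω)
    (X Y : ℝ → Ω → ℝ) (p T ε δ : ℝ) : Prop :=
  (∀ᵐ x ∂P, IntervalIntegrable (fun t => |X t x - Y t x| ^ p) volume 0 T) ∧
    P.real {x | ε < ∫ t in (0 : ℝ)..T, |X t x - Y t x| ^ p} ≤ δ

end

end WKS

/-! The error `X - X_n` is a centred Gaussian process, so a bound on its variance at each time
controls its L^p norm. Variance. Through the spectral measure, the mean square error at `t` is the
integral over the band of |exp(iuθ) - `sampledExp u θ n`|², where u = ωt/π and θ = πλ/ω. The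
sampling sum is a symmetric partial sum of the Fourier series of θ ↦ exp(iuθ) on (-π, π]. Pairing
the terms k and -k in its tail gives cosines with weight of order u/k², which are summed absolutely,
and alternating sines with weight of order 1/k, handled by Abel summation because |θ| ≤ πΛ/ω < π
(`norm_exp_sub_sampledExp_le`). Hence the variance is at most C_n(t)/n². Tail. Let g dominate the
standard deviation and S = ∫ g^p. An exponential-moment estimate and a weighted Hölder inequality
give E(∫|Y|^p)^(s/p) ≤ 2 e^(-s/2) s^(s/2) S^(s/p) for s > p
(`lintegral_lintegral_enorm_rpow_rpow_le`). In Markov's inequality at level ε, the choice s =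
(ε/S)^(2/p) cancels every factor except 2 e^(-s/2). The two entries of the maximum in the hypothesis
say exactly that s > p and that 2 e^(-s/2) < δ. -/

/-! ### Tail estimates for the sampling series -/

/-- Abel's inequality: a nonincreasing nonnegative weight times a sequence with bounded
partial sums. -/
lemma abs_sum_range_mul_le_of_antitone {a z : ℕ → ℝ} {M : ℝ} (ha : Antitone a)
    (ha₀ : ∀ k, 0 ≤ a k) (hM : ∀ m, |∑ k ∈ Finset.range m, z k| ≤ M) (m : ℕ) :
    |∑ k ∈ Finset.range m, a k * z k| ≤ a 0 * M := by
  have hM₀ : 0 ≤ M := by simpa using hM 0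
  -- Summation by parts: the weights on the partial sums are nonnegative and add up to `a 0`.
  have key : ∀ m : ℕ, ∑ k ∈ Finset.range m, a k * z k =
      a m * ∑ k ∈ Finset.range m, z k +
        ∑ k ∈ Finset.range m, (a k - a (k + 1)) * ∑ j ∈ Finset.range (k + 1), z j := by
    intro m
    induction m with
    | zero => simp
    | succ m ih => rw [Finset.sum_range_succ, ih, Finset.sum_range_succ (fun k => (a k - _) * _),
        Finset.sum_range_succ z m]; ring
  rw [key]
  calc _ ≤ a m * M + ∑ k ∈ Finset.range m, (a k - a (k + 1)) * M := by
        refine (abs_add_le _ _).trans (add_le_add ?_ ((Finset.abs_sum_le_sum_abs _ _).trans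
          (Finset.sum_le_sum fun k _ => ?_)))
        · rw [abs_mul, abs_of_nonneg (ha₀ m)]
          exact mul_le_mul_of_nonneg_left (hM m) (ha₀ m)
        · rw [abs_mul, abs_of_nonneg (sub_nonneg.2 (ha (Nat.le_succ k)))]
          exact mul_le_mul_of_nonneg_left (hM _) (sub_nonneg.2 (ha (Nat.le_succ k)))
    _ = a 0 * M := by rw [← Finset.sum_mul, Finset.sum_range_sub']; ring

/-- Partial sums of the alternating sine series are bounded by `1 / cos (θ / 2)`. -/
lemma abs_sum_neg_one_pow_mul_sin_le {θ : ℝ} (hθ : 0 < Real.cos (θ / 2)) (n m : ℕ) :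
    |∑ k ∈ Finset.range m, (-1 : ℝ) ^ (n + k) * Real.sin ((n + k : ℕ) * θ)| ≤
      1 / Real.cos (θ / 2) := by
  -- 2 cos(θ/2) sin(kθ) = sin(kθ + θ/2) + sin(kθ - θ/2), so the alternating signs make the sum
  -- telescope.
  have key : ∀ m : ℕ, 2 * Real.cos (θ / 2) *
      ∑ k ∈ Finset.range m, (-1 : ℝ) ^ (n + k) * Real.sin ((n + k : ℕ) * θ) =
      (-1) ^ n * Real.sin (n * θ - θ / 2) -
        (-1) ^ (n + m) * Real.sin ((n + m : ℕ) * θ - θ / 2) := by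
    intro m
    induction m with
    | zero => simp
    | succ m ih =>
      rw [Finset.sum_range_succ, mul_add, ih]
      have h1 : ((n + (m + 1) : ℕ) : ℝ) * θ - θ / 2 = (n + m : ℕ) * θ + θ / 2 := by
        push_cast; ring
      rw [h1, Real.sin_add, Real.sin_sub _ (θ / 2)]
      rw [Real.sin_sub, ← add_assoc, pow_succ]
      ring
  have habs : ∀ j : ℕ, ∀ x, |(-1 : ℝ) ^ j * Real.sin x| ≤ 1 := by
    intro j x
    rw [abs_mul, abs_pow, abs_neg, abs_one, one_pow, one_mul]
    exact Real.abs_sin_le_one x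
  rw [le_div_iff₀ hθ]
  have h := key m
  have h2 : |2 * Real.cos (θ / 2) *
      ∑ k ∈ Finset.range m, (-1 : ℝ) ^ (n + k) * Real.sin ((n + k : ℕ) * θ)| ≤ 2 := by
    rw [h]
    refine (abs_sub _ _).trans ?_
    linarith [habs n (n * θ - θ / 2), habs (n + m) ((n + m : ℕ) * θ - θ / 2)]
  rw [abs_mul, abs_of_pos (by linarith : 0 < 2 * Real.cos (θ / 2))] at h2
  linarith

/-- The symmetric partial sums of the sampling expansion of `θ ↦ exp (i u θ)`. -/
noncomputable def sampledExp (u θ : ℝ) (N : ℕ) : ℂ :=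
  ∑ k ∈ Finset.Icc (-(N : ℤ)) N,
    (Real.sinc (Real.pi * (u - k)) : ℂ) * Complex.exp (Complex.I * k * θ)

lemma sum_Icc_neg_succ {M : Type*} [AddCommGroup M] (f : ℤ → M) (N : ℕ) :
    ∑ k ∈ Finset.Icc (-((N + 1 : ℕ) : ℤ)) ((N + 1 : ℕ) : ℤ), f k =
      ∑ k ∈ Finset.Icc (-(N : ℤ)) N, f k + (f (N + 1) + f (-(N + 1))) := by
  have : Finset.Icc (-((N + 1 : ℕ) : ℤ)) ((N + 1 : ℕ) : ℤ) =
      insert ((N : ℤ) + 1) (insert (-((N : ℤ) + 1)) (Finset.Icc (-(N : ℤ)) N)) := by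
    ext k; simp only [Finset.mem_Icc, Finset.mem_insert]; push_cast; omega
  rw [this, Finset.sum_insert, Finset.sum_insert]
  · abel
  · simp
  · simp only [Finset.mem_Icc, Finset.mem_insert]; omega

lemma sinc_pi_mul_sub_intCast {u : ℝ} {k : ℤ} (h : u ≠ k) :
    Real.sinc (Real.pi * (u - k)) =
      Real.sin (Real.pi * u) / Real.pi * (-1 : ℝ) ^ k / (u - k) := by
  have hk : u - k ≠ 0 := sub_ne_zero.2 h
  rw [Real.sinc_of_ne_zero (mul_ne_zero Real.pi_ne_zero hk)]
  have : Real.pi * (u - k) = Real.pi * u - k * Real.pi := by ring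
  rw [this, Real.sin_sub_int_mul_pi, ← this]
  field_simp

/-- Over the common denominator k² - u², with k = N + 1, the cosine weight decays like 1/k² but the
sine weight only like 1/k. They are kept apart because the sines need cancellation. The bounds on u
keep it off the nodes ±k. -/
lemma sampledExp_succ_sub {u θ : ℝ} {N : ℕ} (hu : 0 ≤ u) (h : u < N + 1) :
    sampledExp u θ (N + 1) - sampledExp u θ N =
      -(((Real.sin (Real.pi * u) / Real.pi : ℝ) : ℂ) *
        ((2 * u * ((-1) ^ (N + 1) * Real.cos ((N + 1 : ℕ) * θ) / ((N + 1 : ℕ) ^ 2 - u ^ 2)) : ℝ) +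
          (2 * ((N + 1 : ℕ) / ((N + 1 : ℕ) ^ 2 - u ^ 2) *
            ((-1) ^ (N + 1) * Real.sin ((N + 1 : ℕ) * θ))) : ℝ) * Complex.I)) := by
  rw [sampledExp, sum_Icc_neg_succ, sampledExp, add_sub_cancel_left,
    sinc_pi_mul_sub_intCast (by push_cast; exact h.ne),
    sinc_pi_mul_sub_intCast (by push_cast; linarith)]
  have e1 : Complex.exp (Complex.I * (((N : ℤ) + 1 : ℤ) : ℂ) * θ) =
      Complex.cos ((N + 1) * θ) + Complex.sin ((N + 1) * θ) * Complex.I := by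
    rw [← Complex.exp_mul_I]; congr 1; push_cast; ring
  have e2 : Complex.exp (Complex.I * ((-((N : ℤ) + 1) : ℤ) : ℂ) * θ) =
      Complex.cos ((N + 1) * θ) - Complex.sin ((N + 1) * θ) * Complex.I := by
    have h1 := Complex.exp_mul_I (-(((N : ℂ) + 1) * θ))
    rw [Complex.cos_neg, Complex.sin_neg, neg_mul (Complex.sin _), ← sub_eq_add_neg] at h1
    rw [← h1]; congr 1; push_cast; ring
  rw [e1, e2]
  have p1 : (-1 : ℝ) ^ ((N : ℤ) + 1) = (-1) ^ (N + 1) := by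
    exact_mod_cast zpow_natCast (-1 : ℝ) (N + 1)
  have p2 : (-1 : ℝ) ^ (-((N : ℤ) + 1)) = (-1) ^ (N + 1) := by
    rw [zpow_neg, p1, ← inv_pow]; norm_num
  rw [p1, p2]
  have d1 : (u : ℂ) - ((N : ℂ) + 1) ≠ 0 := by
    have : u - (N + 1) ≠ 0 := by linarith
    exact_mod_cast this
  have d2 : (u : ℂ) + ((N : ℂ) + 1) ≠ 0 := by
    have : u + (N + 1) ≠ 0 := by positivity
    exact_mod_cast this
  have d3 : ((N : ℂ) + 1) ^ 2 - (u : ℂ) ^ 2 ≠ 0 := by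
    have : ((N : ℂ) + 1) ^ 2 - (u : ℂ) ^ 2 = -((u - (N + 1)) * (u + (N + 1))) := by ring
    rw [this]; exact neg_ne_zero.2 (mul_ne_zero d1 d2)
  have d2' : (u : ℂ) - (-((N : ℂ) + 1)) ≠ 0 := by rwa [sub_neg_eq_add]
  have q1 : 1 / ((u : ℂ) - ((N : ℂ) + 1)) =
      -((u : ℂ) + (N + 1)) / (((N : ℂ) + 1) ^ 2 - (u : ℂ) ^ 2) := by
    rw [div_eq_div_iff d1 d3]; ring
  have q2 : 1 / ((u : ℂ) - (-((N : ℂ) + 1))) =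
      -((u : ℂ) - (N + 1)) / (((N : ℂ) + 1) ^ 2 - (u : ℂ) ^ 2) := by
    rw [div_eq_div_iff d2' d3]; ring
  push_cast
  rw [div_eq_mul_one_div _ ((u : ℂ) - ((N : ℂ) + 1)), q1,
    div_eq_mul_one_div _ ((u : ℂ) - (-((N : ℂ) + 1))), q2]
  ring

lemma sum_range_one_div_sq_le {n : ℕ} (hn : 0 < n) (m : ℕ) :
    ∑ j ∈ Finset.range m, 1 / ((n + j + 1 : ℕ) : ℝ) ^ 2 ≤ 1 / (n : ℝ) := by
  have key : ∀ m : ℕ, ∑ j ∈ Finset.range m, 1 / ((n + j + 1 : ℕ) : ℝ) ^ 2 ≤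
      1 / (n : ℝ) - 1 / ((n + m : ℕ) : ℝ) := by
    intro m
    induction m with
    | zero => simp
    | succ m ih =>
      rw [Finset.sum_range_succ]
      have h0 : (0 : ℝ) < (n + m : ℕ) := by positivity
      have : 1 / ((n + m + 1 : ℕ) : ℝ) ^ 2 ≤
          1 / ((n + m : ℕ) : ℝ) - 1 / ((n + (m + 1) : ℕ) : ℝ) := by
        have e : ((n + (m + 1) : ℕ) : ℝ) = (n + m : ℕ) + 1 := by push_cast; ring
        have e' : ((n + m + 1 : ℕ) : ℝ) = (n + m : ℕ) + 1 := by push_cast; ring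
        rw [e, e', div_sub_div _ _ h0.ne' (by positivity), div_le_div_iff₀ (by positivity)
          (by positivity)]
        nlinarith
      linarith
  exact (key m).trans (sub_le_self _ (by positivity))

/-- Concavity of the cosine on [0, π/2]. With r = Λ/ω this produces the factor 1 - Λ/ω, the gain
from oversampling. -/
lemma one_sub_le_cos_half {θ r : ℝ} (hr : r < 1) (hθ : |θ| ≤ Real.pi * r) :
    1 - r ≤ Real.cos (θ / 2) := by
  have hpi := Real.pi_pos
  have h := Real.one_sub_mul_le_cos (x := |θ| / 2) (by positivity) (by nlinarith)
  have h2 : 2 / Real.pi * (|θ| / 2) ≤ r := by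
    rw [div_mul_div_comm, div_le_iff₀ (by positivity)]; nlinarith
  have : Real.cos (|θ| / 2) = Real.cos (θ / 2) := by
    rw [← Real.cos_abs (θ / 2), abs_div, abs_two]
  linarith

/-- Tails of the sampling expansion are uniformly bounded. -/
lemma norm_sampledExp_add_sub_le {u θ z r : ℝ} {n : ℕ} (hn : 0 < n) (hz : z < 1)
    (hu : 0 ≤ u) (hun : u ^ 2 ≤ n ^ 2 * z) (hr : r < 1) (hθ : |θ| ≤ Real.pi * r) (m : ℕ) :
    ‖sampledExp u θ (n + m) - sampledExp u θ n‖ ≤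
      (2 * u / (Real.pi * (1 - z)) + 2 / (Real.pi * (1 - z) * (1 - r))) / n := by
  have hpi := Real.pi_pos
  have hz' : 0 < 1 - z := by linarith
  have hr' : 0 < 1 - r := by linarith
  have hn' : (0 : ℝ) < n := by exact_mod_cast hn
  have hun' : u < n := by
    refine lt_of_pow_lt_pow_left₀ 2 hn'.le (hun.trans_lt ?_)
    nlinarith [sq_nonneg (n : ℝ), pow_pos hn' 2]
  have hcos : 0 < Real.cos (θ / 2) := hr'.trans_le (one_sub_le_cos_half hr hθ)
  -- For j = n + k + 1 > n one has u² ≤ z n² ≤ z j², so the denominators stay comparable to j².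
  have hden : ∀ k : ℕ, (1 - z) * ((n + k + 1 : ℕ) : ℝ) ^ 2 ≤ ((n + k + 1 : ℕ) : ℝ) ^ 2 - u ^ 2 := by
    intro k
    have hz0 : 0 ≤ z := by
      by_contra h
      nlinarith [sq_nonneg u, pow_pos hn' 2]
    have : (n : ℝ) ^ 2 ≤ ((n + k + 1 : ℕ) : ℝ) ^ 2 := by
      gcongr; omega
    nlinarith
  have hden0 : ∀ k : ℕ, 0 < ((n + k + 1 : ℕ) : ℝ) ^ 2 - u ^ 2 := fun k =>
    lt_of_lt_of_le (by positivity) (hden k)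
  set A : ℕ → ℝ := fun k =>
    (-1) ^ (n + k + 1) * Real.cos ((n + k + 1 : ℕ) * θ) / (((n + k + 1 : ℕ) : ℝ) ^ 2 - u ^ 2) with hA
  set a : ℕ → ℝ := fun k => ((n + k + 1 : ℕ) : ℝ) / (((n + k + 1 : ℕ) : ℝ) ^ 2 - u ^ 2) with ha
  set s : ℕ → ℝ := fun k => (-1) ^ (n + k + 1) * Real.sin ((n + k + 1 : ℕ) * θ) with hs
  have expand : sampledExp u θ (n + m) - sampledExp u θ n =
      -(((Real.sin (Real.pi * u) / Real.pi : ℝ) : ℂ) *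
        ((2 * u * ∑ k ∈ Finset.range m, A k : ℝ) +
          (2 * ∑ k ∈ Finset.range m, a k * s k : ℝ) * Complex.I)) := by
    induction m with
    | zero => simp
    | succ m ih =>
      rw [← add_assoc, ← sub_add_sub_cancel _ (sampledExp u θ (n + m)), ih,
        sampledExp_succ_sub hu (by push_cast; linarith [(Nat.cast_nonneg m : (0 : ℝ) ≤ m)]),
        Finset.sum_range_succ, Finset.sum_range_succ]
      simp only [hA, ha, hs]
      push_cast
      ring
  have hAle : |∑ k ∈ Finset.range m, A k| ≤ 1 / (1 - z) * (1 / n) := by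
    refine (Finset.abs_sum_le_sum_abs _ _).trans ?_
    refine le_trans (Finset.sum_le_sum fun k _ => ?_)
      ((Finset.mul_sum _ _ _).symm.trans_le
        (mul_le_mul_of_nonneg_left (sum_range_one_div_sq_le hn m) (by positivity)))
    simp only [hA]
    rw [abs_div, abs_mul, abs_pow, abs_neg, abs_one, one_pow, one_mul, abs_of_pos (hden0 k),
      div_mul_div_comm, one_mul]
    exact div_le_div₀ zero_le_one (Real.abs_cos_le_one _) (by positivity) (hden k)
  have hsle : |∑ k ∈ Finset.range m, a k * s k| ≤ 1 / ((1 - z) * n) * (1 / (1 - r)) := by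
    -- The weight is 1/(j - u²/j) with j = n + k + 1, and its denominator increases with j.
    have hanti : Antitone a := by
      refine antitone_nat_of_succ_le fun k => ?_
      simp only [ha]
      rw [div_le_div_iff₀ (hden0 _) (hden0 _)]
      have : ((n + (k + 1) + 1 : ℕ) : ℝ) = (n + k + 1 : ℕ) + 1 := by push_cast; ring
      rw [this]
      nlinarith [sq_nonneg u, (Nat.cast_nonneg (n + k + 1) : (0 : ℝ) ≤ (n + k + 1 : ℕ))]
    have h1 := abs_sum_range_mul_le_of_antitone (z := s) hanti
      (fun k => div_nonneg (by positivity) (hden0 k).le) (M := 1 / Real.cos (θ / 2))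
      (fun m => by
        have := abs_sum_neg_one_pow_mul_sin_le hcos (n + 1) m
        simpa only [hs, add_right_comm n 1] using this) m
    refine h1.trans (mul_le_mul ?_ ?_ (by positivity) (by positivity))
    · have h2 := hden 0
      simp only [ha]
      rw [div_le_div_iff₀ (hden0 0) (by positivity), one_mul]
      refine le_trans ?_ h2
      push_cast
      nlinarith [mul_pos hz' hn']
    · exact one_div_le_one_div_of_le hr' (one_sub_le_cos_half hr hθ)
  rw [expand, norm_neg, norm_mul]
  have hsin : ‖((Real.sin (Real.pi * u) / Real.pi : ℝ) : ℂ)‖ ≤ 1 / Real.pi := by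
    rw [Complex.norm_real, Real.norm_eq_abs, abs_div, abs_of_pos hpi]
    gcongr
    exact Real.abs_sin_le_one _
  calc _ ≤ 1 / Real.pi * (2 * u * (1 / (1 - z) * (1 / n)) +
        2 * (1 / ((1 - z) * n) * (1 / (1 - r)))) := by
        refine mul_le_mul hsin ((norm_add_le _ _).trans (add_le_add ?_ ?_)) (norm_nonneg _)
          (by positivity)
        · rw [Complex.norm_real, Real.norm_eq_abs, abs_mul, abs_of_nonneg (by positivity)]
          gcongr
        · rw [norm_mul, Complex.norm_I, mul_one, Complex.norm_real, Real.norm_eq_abs, abs_mul,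
            abs_two]
          gcongr
    _ = _ := by field_simp

/-! ### Fourier series of the exponential and its truncation error -/

section SamplingExpansion

local instance : Fact (0 < 2 * Real.pi) := ⟨Real.two_pi_pos⟩

/-- For c = u - k this is the k-th Fourier coefficient of θ ↦ exp(iuθ), which identifies the
sampling sum with a Fourier partial sum. -/
lemma intervalIntegral_exp_mul_I_eq_sinc (c : ℝ) :
    (1 / (2 * Real.pi)) • ∫ x in -Real.pi..Real.pi, Complex.exp ((c : ℂ) * Complex.I * x) =
      (Real.sinc (Real.pi * c) : ℂ) := by
  have hpi := Real.pi_ne_zero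
  rcases eq_or_ne c 0 with rfl | hc
  · simp only [Complex.ofReal_zero, zero_mul, Complex.exp_zero, mul_zero, Real.sinc_zero]
    rw [intervalIntegral.integral_const, smul_smul]
    have : 1 / (2 * Real.pi) * (Real.pi - -Real.pi) = 1 := by field_simp; ring
    rw [this]; simp
  · have hcI : (c : ℂ) * Complex.I ≠ 0 := mul_ne_zero (by exact_mod_cast hc) Complex.I_ne_zero
    rw [integral_exp_mul_complex hcI, Real.sinc_of_ne_zero (mul_ne_zero hpi hc)]
    have hs : (Real.sin (Real.pi * c) : ℂ) =
        (Complex.exp (c * Complex.I * Real.pi) - Complex.exp (c * Complex.I * (-Real.pi : ℝ))) /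
          (2 * Complex.I) := by
      rw [Complex.ofReal_sin, Complex.sin]
      have e1 : (c : ℂ) * Complex.I * Real.pi = (Real.pi * c : ℝ) * Complex.I := by
        push_cast; ring
      have e2 : (c : ℂ) * Complex.I * (-Real.pi : ℝ) = -(Real.pi * c : ℝ) * Complex.I := by
        push_cast; ring
      rw [e1, e2]
      field_simp
      rw [Complex.I_sq]; ring
    rw [Complex.ofReal_div, hs, Complex.real_smul]
    have h1 : (c : ℂ) ≠ 0 := by exact_mod_cast hc
    have h2 : (Real.pi : ℂ) ≠ 0 := by exact_mod_cast hpi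
    have h3 := Complex.I_ne_zero
    push_cast
    field_simp

/-- Along a subsequence, the sampling expansion of `θ ↦ exp (i u θ)` converges a.e. on
`(-π, π]`. -/
lemma exists_seq_tendsto_sampledExp (u : ℝ) :
    ∃ ns : ℕ → ℕ, StrictMono ns ∧ ∀ᵐ θ : ℝ, θ ∈ Set.Ioc (-Real.pi) Real.pi →
      Filter.Tendsto (fun i => sampledExp u θ (ns i)) Filter.atTop
        (nhds (Complex.exp (Complex.I * u * θ))) := by
  set g : ℝ → ℂ := fun θ => Complex.exp (Complex.I * u * θ) with hg
  have hgc : Continuous g := by fun_prop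
  have hL : MemLp g 2 (volume.restrict (Set.Ioc (-Real.pi) (-Real.pi + 2 * Real.pi))) := by
    refine MemLp.of_bound hgc.aestronglyMeasurable 1 (Filter.Eventually.of_forall fun θ => ?_)
    simp [hg, Complex.norm_exp]
  have h := hL.memLp_liftIoc.haarAddCircle
  have hcoef : ∀ k : ℤ, fourierCoeff (h.toLp : AddCircle (2 * Real.pi) → ℂ) k =
      (Real.sinc (Real.pi * (u - k)) : ℂ) := by
    intro k
    rw [fourierCoeff_congr_ae h.coeFn_toLp, fourierCoeff_liftIoc_eq, fourierCoeffOn_eq_integral,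
      ← intervalIntegral_exp_mul_I_eq_sinc]
    have e : -Real.pi + 2 * Real.pi = Real.pi := by ring
    rw [e]
    have e' : Real.pi - -Real.pi = 2 * Real.pi := by ring
    congr 1
    · rw [e']
    · refine intervalIntegral.integral_congr fun θ _ => ?_
      simp only [hg]
      rw [fourier_coe_apply, smul_eq_mul, ← Complex.exp_add]
      congr 1
      have h2 : (Real.pi : ℂ) ≠ 0 := by exact_mod_cast Real.pi_ne_zero
      push_cast
      rw [show (Real.pi : ℂ) - -Real.pi = 2 * Real.pi by ring]
      field_simp
      ring
  have hsum := Filter.Tendsto.comp (hasSum_fourier_series_L2 h.toLp) (Finset.tendsto_Icc_neg_atTop_atTop.comp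
    tendsto_natCast_atTop_atTop)
  -- L² convergence gives convergence in measure, hence almost everywhere along a subsequence. This
  -- is enough, since the tail bound is uniform in the upper index.
  obtain ⟨ns, hns, hlim⟩ := (tendstoInMeasure_of_tendsto_Lp hsum).exists_seq_tendsto_ae
  refine ⟨ns, hns, ?_⟩
  have hpart : ∀ᵐ x ∂(AddCircle.haarAddCircle (T := 2 * Real.pi)), ∀ N : ℕ,
      (∑ k ∈ Finset.Icc (-(N : ℤ)) N, fourierCoeff (h.toLp : AddCircle (2 * Real.pi) → ℂ) k •
        (fourierLp 2 k : Lp ℂ 2 (AddCircle.haarAddCircle (T := 2 * Real.pi))) :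
          Lp ℂ 2 (AddCircle.haarAddCircle (T := 2 * Real.pi))) x =
      ∑ k ∈ Finset.Icc (-(N : ℤ)) N, (Real.sinc (Real.pi * (u - k)) : ℂ) * fourier k x := by
    have hall : ∀ᵐ x ∂(AddCircle.haarAddCircle (T := 2 * Real.pi)), ∀ k : ℤ,
        (fourierCoeff (h.toLp : AddCircle (2 * Real.pi) → ℂ) k • (fourierLp 2 k :
          Lp ℂ 2 (AddCircle.haarAddCircle (T := 2 * Real.pi))) :
          Lp ℂ 2 (AddCircle.haarAddCircle (T := 2 * Real.pi))) x =
        (Real.sinc (Real.pi * (u - k)) : ℂ) * fourier k x := by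
      rw [ae_all_iff]
      intro k
      filter_upwards [Lp.coeFn_smul (fourierCoeff (h.toLp : AddCircle (2 * Real.pi) → ℂ) k)
        (fourierLp 2 k : Lp ℂ 2 (AddCircle.haarAddCircle (T := 2 * Real.pi))),
        coeFn_fourierLp (T := 2 * Real.pi) 2 k] with x h1 h2
      rw [h1, Pi.smul_apply, h2, hcoef, smul_eq_mul]
    rw [ae_all_iff]
    intro N
    filter_upwards [hall, Lp.coeFn_fun_finsetSum (Finset.Icc (-(N : ℤ)) N) (fun k =>
      (fourierCoeff (h.toLp : AddCircle (2 * Real.pi) → ℂ) k •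
        (fourierLp 2 k : Lp ℂ 2 (AddCircle.haarAddCircle (T := 2 * Real.pi)))))] with x h1 h2
    rw [h2]
    exact Finset.sum_congr rfl fun k _ => h1 k
  have hcircle : ∀ᵐ x ∂(volume : Measure (AddCircle (2 * Real.pi))),
      Filter.Tendsto (fun i => ∑ k ∈ Finset.Icc (-(ns i : ℤ)) (ns i),
        (Real.sinc (Real.pi * (u - k)) : ℂ) * fourier k x) Filter.atTop
        (nhds (AddCircle.liftIoc (2 * Real.pi) (-Real.pi) g x)) := by
    rw [AddCircle.volume_eq_smul_haarAddCircle]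
    refine Measure.ae_smul_measure ?_ _
    filter_upwards [hlim, hpart, h.coeFn_toLp] with x h1 h2 h3
    rw [← h3]
    refine h1.congr fun i => ?_
    exact h2 (ns i)
  have hline := (AddCircle.measurePreserving_mk (2 * Real.pi) (-Real.pi)).quasiMeasurePreserving.ae
    hcircle
  rw [ae_restrict_iff' measurableSet_Ioc] at hline
  filter_upwards [hline] with θ hθ hmem
  have hmem' : θ ∈ Set.Ioc (-Real.pi) (-Real.pi + 2 * Real.pi) := by
    convert hmem using 2; ring
  have hfin := hθ hmem'
  rw [AddCircle.liftIoc_coe_apply hmem'] at hfin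
  refine hfin.congr fun i => Finset.sum_congr rfl fun k _ => ?_
  rw [fourier_coe_apply]
  congr 2
  have h2 : (Real.pi : ℂ) ≠ 0 := by exact_mod_cast Real.pi_ne_zero
  push_cast
  field_simp

end SamplingExpansion

/-- Truncation error of the sampling expansion. -/
lemma norm_exp_sub_sampledExp_le {u θ z r : ℝ} {n : ℕ} (hn : 0 < n) (hz : z < 1)
    (hu : 0 ≤ u) (hun : u ^ 2 ≤ n ^ 2 * z) (hr₀ : 0 < r) (hr : r < 1)
    (hθ : |θ| ≤ Real.pi * r) :
    ‖Complex.exp (Complex.I * u * θ) - sampledExp u θ n‖ ≤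
      (2 * u / (Real.pi * (1 - z)) + 2 / (Real.pi * (1 - z) * (1 - r))) / n := by
  have hpi := Real.pi_pos
  obtain ⟨ns, hns, hae⟩ := exists_seq_tendsto_sampledExp u
  have hdense := Measure.dense_of_ae hae
  set C := (2 * u / (Real.pi * (1 - z)) + 2 / (Real.pi * (1 - z) * (1 - r))) / n
  -- The bound is a closed condition on θ. It holds on a dense subset of the open interval, by
  -- letting the upper index tend to infinity in the tail bound, and so extends to the closed
  -- interval, endpoints included.
  set G := {θ : ℝ | ‖Complex.exp (Complex.I * u * θ) - sampledExp u θ n‖ ≤ C} with hG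
  have hclosed : IsClosed G := by
    refine isClosed_le ?_ continuous_const
    unfold sampledExp
    fun_prop
  have hsub := hdense.open_subset_closure_inter
    (isOpen_Ioo (a := -(Real.pi * r)) (b := Real.pi * r))
  have hinG : Set.Ioo (-(Real.pi * r)) (Real.pi * r) ∩ {θ : ℝ | θ ∈ Set.Ioc (-Real.pi) Real.pi →
      Filter.Tendsto (fun i => sampledExp u θ (ns i)) Filter.atTop
        (nhds (Complex.exp (Complex.I * u * θ)))} ⊆ G := by
    rintro x ⟨hx, hx'⟩
    have ht := hx' ⟨by nlinarith [hx.1], by nlinarith [hx.2]⟩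
    refine le_of_tendsto (ht.sub_const (sampledExp u x n)).norm ?_
    filter_upwards [Filter.eventually_ge_atTop n] with i hi
    obtain ⟨m, hm⟩ := Nat.exists_eq_add_of_le (hi.trans (hns.le_apply (x := i)))
    change ‖sampledExp u x (ns i) - _‖ ≤ C
    rw [hm]
    exact norm_sampledExp_add_sub_le hn hz hu hun hr (abs_le.2 ⟨hx.1.le, hx.2.le⟩) m
  have hIcc : Set.Icc (-(Real.pi * r)) (Real.pi * r) ⊆ G := by
    have hne : -(Real.pi * r) ≠ Real.pi * r := by nlinarith [mul_pos hpi hr₀]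
    rw [← closure_Ioo hne]
    exact closure_minimal (hsub.trans (closure_minimal hinG hclosed)) hclosed
  exact hIcc (abs_le.1 hθ)

/-! ### Moments and tails of L^p norms of Gaussian processes -/

/-- Absolute moments of a centred Gaussian variable of standard deviation at most `σ`. -/
lemma lintegral_enorm_rpow_le_of_hasGaussianLaw {Ω : Type*} [MeasurableSpace Ω] {P : Measure Ω}
    {Y : Ω → ℝ} (hY : HasGaussianLaw Y P) (h0 : ∫ x, Y x ∂P = 0) {σ s : ℝ} (hσ : 0 < σ)
    (hs : 0 < s) (hvar : ∫ x, Y x ^ 2 ∂P ≤ σ ^ 2) :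
    ∫⁻ x, ‖Y x‖ₑ ^ s ∂P ≤ ENNReal.ofReal (2 * Real.exp (-s / 2) * (√s * σ) ^ s) := by
  have := hY.isProbabilityMeasure
  have hs' : 0 < √s := Real.sqrt_pos.2 hs
  have hss : √s * √s = s := Real.mul_self_sqrt hs.le
  -- This value minimises (s/(e a))^s exp(a²σ²/2), the bound that comes from |y|^s ≤ (s/(e a))^s
  -- exp(a|y|).
  set a := √s / σ with ha
  have ha0 : 0 < a := div_pos hs' hσ
  have hmap := hY.map_eq_gaussianReal
  have hv : Var[Y; P] ≤ σ ^ 2 := by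
    rw [variance_of_integral_eq_zero hY.aemeasurable h0]; exact hvar
  rw [h0] at hmap
  have hmgf : ∀ b : ℝ, b ^ 2 = a ^ 2 → mgf Y P b ≤ Real.exp (s / 2) := by
    intro b hb
    rw [mgf_gaussianReal hmap, hb]
    refine Real.exp_le_exp.2 ?_
    rw [Real.coe_toNNReal _ (variance_nonneg _ _), zero_mul, zero_add]
    have : σ ^ 2 * a ^ 2 = s := by
      rw [ha]; field_simp; rw [Real.sq_sqrt hs.le]
    nlinarith [mul_le_mul_of_nonneg_right hv (sq_nonneg a)]
  have hint : ∀ b : ℝ, Integrable (fun x => Real.exp (b * Y x)) P := by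
    intro b
    have h1 : Integrable (fun y => Real.exp (b * y)) (P.map Y) := by
      rw [hmap]; exact integrable_exp_mul_gaussianReal b
    exact h1.comp_aemeasurable hY.aemeasurable
  have hpt : ∀ y : ℝ, |y| ^ s ≤
      (√s * σ) ^ s * Real.exp (-s) * (Real.exp (a * y) + Real.exp (-a * y)) := by
    intro y
    -- The inequality x ≤ e^(x-1) at x = a|y|/s, raised to the power s.
    have h1 : (a * |y| / s) ^ s ≤ Real.exp (a * |y| - s) := by
      have h2 : a * |y| / s ≤ Real.exp (a * |y| / s - 1) := by
        linarith [Real.add_one_le_exp (a * |y| / s - 1)]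
      calc (a * |y| / s) ^ s ≤ (Real.exp (a * |y| / s - 1)) ^ s :=
            Real.rpow_le_rpow (by positivity) h2 hs.le
        _ = _ := by rw [← Real.exp_mul]; congr 1; field_simp
    have h3 : |y| = (√s * σ) * (a * |y| / s) := by
      rw [ha]; field_simp; rw [Real.sq_sqrt hs.le]
    have h4 : Real.exp (a * |y|) ≤ Real.exp (a * y) + Real.exp (-a * y) := by
      rcases abs_cases y with ⟨h, -⟩ | ⟨h, -⟩ <;> rw [h]
      · linarith [Real.exp_pos (-a * y)]
      · rw [mul_neg, ← neg_mul]; linarith [Real.exp_pos (a * y)]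
    calc |y| ^ s = (√s * σ) ^ s * (a * |y| / s) ^ s := by
          rw [← Real.mul_rpow (by positivity) (by positivity), ← h3]
      _ ≤ (√s * σ) ^ s * (Real.exp (-s) * (Real.exp (a * y) + Real.exp (-a * y))) := by
          refine mul_le_mul_of_nonneg_left (h1.trans ?_) (by positivity)
          rw [sub_eq_neg_add, Real.exp_add]
          gcongr
      _ = _ := by ring
  have hbound : ∫ x, (√s * σ) ^ s * Real.exp (-s) *
      (Real.exp (a * Y x) + Real.exp (-a * Y x)) ∂P ≤
      2 * Real.exp (-s / 2) * (√s * σ) ^ s := by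
    rw [integral_const_mul, integral_add (hint a) (hint (-a))]
    have h1 := hmgf a rfl
    have h2 := hmgf (-a) (neg_sq a)
    have e : Real.exp (-s) * Real.exp (s / 2) = Real.exp (-s / 2) := by
      rw [← Real.exp_add]; congr 1; ring
    calc _ ≤ (√s * σ) ^ s * Real.exp (-s) * (Real.exp (s / 2) + Real.exp (s / 2)) := by
          refine mul_le_mul_of_nonneg_left (add_le_add h1 h2) (by positivity)
      _ = _ := by rw [← e]; ring
  calc ∫⁻ x, ‖Y x‖ₑ ^ s ∂P
      ≤ ∫⁻ x, ENNReal.ofReal ((√s * σ) ^ s * Real.exp (-s) *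
          (Real.exp (a * Y x) + Real.exp (-a * Y x))) ∂P := by
        refine lintegral_mono fun x => ?_
        rw [Real.enorm_eq_ofReal_abs, ENNReal.ofReal_rpow_of_nonneg (abs_nonneg _) hs.le]
        exact ENNReal.ofReal_le_ofReal (hpt _)
    _ = ENNReal.ofReal (∫ x, (√s * σ) ^ s * Real.exp (-s) *
          (Real.exp (a * Y x) + Real.exp (-a * Y x)) ∂P) := by
        refine (ofReal_integral_eq_lintegral_ofReal (((hint a).add (hint (-a))).const_mul _)
          (Filter.Eventually.of_forall fun x => ?_)).symm
        change 0 ≤ (√s * σ) ^ s * Real.exp (-s) * (Real.exp (a * Y x) + Real.exp (-a * Y x))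
        positivity
    _ ≤ _ := ENNReal.ofReal_le_ofReal hbound

/-- Hölder's inequality with weights: an `L^p` norm is controlled by a weighted `L^s` norm. -/
lemma lintegral_rpow_rpow_le_weighted {α : Type*} [MeasurableSpace α] {μ : Measure α}
    {f G : α → ENNReal} (hf : AEMeasurable f μ) (hG : AEMeasurable G μ)
    (hG0 : ∀ᵐ t ∂μ, G t ≠ 0) (hGt : ∀ᵐ t ∂μ, G t ≠ ⊤) {p s : ℝ} (hp : 0 < p) (hps : p < s) :
    (∫⁻ t, f t ^ p ∂μ) ^ (s / p) ≤
      (∫⁻ t, f t ^ s * G t ^ (p - s) ∂μ) * (∫⁻ t, G t ^ p ∂μ) ^ (s / p - 1) := by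
  have hs : 0 < s := hp.trans hps
  have hq1 : 1 < s / p := (one_lt_div hp).2 hps
  have hq : 0 < s / p := by linarith
  set q := s / p with hqdef
  have hconj := Real.HolderConjugate.conjExponent hq1
  set q' := q.conjExponent with hq'
  have hq'0 : 0 < q' := hconj.symm.pos
  have hqq : q / q' = q - 1 := by
    rw [hq', Real.conjExponent]; field_simp
  have hpq : p * q = s := by rw [hqdef]; field_simp
  -- Hölder with exponents q = s/p and q' is applied to f^p = (f^p G^(-p/q')) · G^(p/q').
  have hmul : ∫⁻ t, f t ^ p ∂μ =
      ∫⁻ t, ((fun t => f t ^ p * G t ^ (-(p / q'))) * fun t => G t ^ (p / q')) t ∂μ := by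
    refine lintegral_congr_ae ?_
    filter_upwards [hG0, hGt] with t h0 ht
    simp only [Pi.mul_apply]
    rw [mul_assoc, ← ENNReal.rpow_add _ _ h0 ht, neg_add_cancel, ENNReal.rpow_zero, mul_one]
  have hH := ENNReal.lintegral_mul_le_Lp_mul_Lq μ hconj
    (f := fun t => f t ^ p * G t ^ (-(p / q'))) (g := fun t => G t ^ (p / q'))
    ((hf.pow_const _).mul (hG.pow_const _)) (hG.pow_const _)
  rw [← hmul] at hH
  have e1 : ∀ t, (f t ^ p * G t ^ (-(p / q'))) ^ q = f t ^ s * G t ^ (p - s) := by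
    intro t
    rw [ENNReal.mul_rpow_of_nonneg _ _ hq.le, ← ENNReal.rpow_mul, ← ENNReal.rpow_mul, hpq]
    congr 2
    calc -(p / q') * q = -(p * (q / q')) := by ring
      _ = p - s := by rw [hqq, ← hpq]; ring
  have e2 : ∀ t, (G t ^ (p / q')) ^ q' = G t ^ p := by
    intro t
    rw [← ENNReal.rpow_mul]; congr 1; field_simp
  simp only [e1, e2] at hH
  calc (∫⁻ t, f t ^ p ∂μ) ^ q ≤ _ := ENNReal.rpow_le_rpow hH hq.le
    _ = _ := by
      rw [ENNReal.mul_rpow_of_nonneg _ _ hq.le, ← ENNReal.rpow_mul, ← ENNReal.rpow_mul]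
      congr 1
      · rw [one_div_mul_cancel hq.ne', ENNReal.rpow_one]
      · congr 1
        rw [← hqq]; ring

/-- Moments of the `L^p` norm of a centred Gaussian process with standard deviation dominated
by `g`. -/
lemma lintegral_lintegral_enorm_rpow_rpow_le {α Ω : Type*} [MeasurableSpace α]
    [MeasurableSpace Ω] {μ : Measure α} [SFinite μ] {P : Measure Ω} [SFinite P] {Y : α → Ω → ℝ}
    (hmeas : AEMeasurable (fun q : α × Ω => Y q.1 q.2) (μ.prod P))
    (hY : ∀ t, HasGaussianLaw (Y t) P) (h0 : ∀ t, ∫ x, Y t x ∂P = 0) {g : α → ℝ}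
    (hg : Measurable g) (hgpos : ∀ᵐ t ∂μ, 0 < g t)
    (hvar : ∀ᵐ t ∂μ, ∫ x, Y t x ^ 2 ∂P ≤ g t ^ 2) {p s : ℝ} (hp : 0 < p) (hps : p < s)
    (hS0 : ∫⁻ t, ENNReal.ofReal (g t) ^ p ∂μ ≠ 0) (hSt : ∫⁻ t, ENNReal.ofReal (g t) ^ p ∂μ ≠ ⊤) :
    ∫⁻ x, (∫⁻ t, ‖Y t x‖ₑ ^ p ∂μ) ^ (s / p) ∂P ≤
      ENNReal.ofReal (2 * Real.exp (-s / 2) * √s ^ s) *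
        (∫⁻ t, ENNReal.ofReal (g t) ^ p ∂μ) ^ (s / p) := by
  have hs : 0 < s := hp.trans hps
  set S := ∫⁻ t, ENNReal.ofReal (g t) ^ p ∂μ with hS
  have hGm : Measurable fun t => ENNReal.ofReal (g t) := hg.ennreal_ofReal
  have hsec : ∀ᵐ x ∂P, AEMeasurable (fun t => Y t x) μ := by
    have h1 : AEStronglyMeasurable (fun q : Ω × α => Y q.2 q.1) (P.prod μ) :=
      hmeas.aestronglyMeasurable.prod_swap
    filter_upwards [h1.prodMk_left] with x hx
    exact hx.aemeasurable
  have hpos : ∀ᵐ t ∂μ, ENNReal.ofReal (g t) ≠ 0 := by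
    filter_upwards [hgpos] with t ht
    simpa using ht
  have hjoint : AEMeasurable (Function.uncurry fun (x : Ω) (t : α) =>
      ‖Y t x‖ₑ ^ s * ENNReal.ofReal (g t) ^ (p - s)) (P.prod μ) := by
    have h1 : AEMeasurable (fun q : Ω × α => Y q.2 q.1) (P.prod μ) :=
      (hmeas.aestronglyMeasurable.prod_swap).aemeasurable
    exact (h1.enorm.pow_const s).mul ((hGm.comp measurable_snd).pow_const _).aemeasurable
  -- After Fubini, the s-th moment at time t contributes g^s, and the weight g^(p-s) turns it back
  -- into g^p. The result is S · S^(s/p-1), with no integral of g^s.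
  calc ∫⁻ x, (∫⁻ t, ‖Y t x‖ₑ ^ p ∂μ) ^ (s / p) ∂P
      ≤ ∫⁻ x, (∫⁻ t, ‖Y t x‖ₑ ^ s * ENNReal.ofReal (g t) ^ (p - s) ∂μ) * S ^ (s / p - 1) ∂P := by
        refine lintegral_mono_ae ?_
        filter_upwards [hsec] with x hx
        exact lintegral_rpow_rpow_le_weighted hx.enorm hGm.aemeasurable hpos
          (Filter.Eventually.of_forall fun t => ENNReal.ofReal_ne_top) hp hps
    _ = (∫⁻ t, ∫⁻ x, ‖Y t x‖ₑ ^ s * ENNReal.ofReal (g t) ^ (p - s) ∂P ∂μ) * S ^ (s / p - 1) := by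
        rw [lintegral_mul_const' _ _ (ENNReal.rpow_ne_top_of_ne_zero hS0 hSt),
          lintegral_lintegral_swap hjoint]
    _ ≤ (∫⁻ t, ENNReal.ofReal (2 * Real.exp (-s / 2) * √s ^ s) * ENNReal.ofReal (g t) ^ p ∂μ) *
          S ^ (s / p - 1) := by
        gcongr ?_ * _
        refine lintegral_mono_ae ?_
        filter_upwards [hgpos, hvar, hpos] with t ht hv ht0
        rw [lintegral_mul_const' _ _ (ENNReal.rpow_ne_top_of_ne_zero ht0 ENNReal.ofReal_ne_top)]
        have h1 := lintegral_enorm_rpow_le_of_hasGaussianLaw (hY t) (h0 t) ht hs hv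
        rw [Real.mul_rpow (Real.sqrt_nonneg _) ht.le, ← mul_assoc,
          ENNReal.ofReal_mul (by positivity), ← ENNReal.ofReal_rpow_of_nonneg ht.le hs.le] at h1
        calc _ ≤ _ := mul_le_mul_left h1 _
          _ = _ := by
            rw [mul_assoc, ← ENNReal.rpow_add _ _ ht0 ENNReal.ofReal_ne_top]
            congr 2; ring
    _ = _ := by
        rw [lintegral_const_mul _ (hGm.pow_const p), ← hS, mul_assoc]
        congr 1
        nth_rw 1 [← ENNReal.rpow_one S]
        rw [← ENNReal.rpow_add _ _ hS0 hSt]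
        congr 1; ring

/-- Tail bound for the `L^p([0,T])` norm of a centred Gaussian process whose standard deviation
is dominated by `g`. -/
lemma measureReal_lt_integral_abs_rpow_le {Ω : Type*} [MeasurableSpace Ω] {P : Measure Ω}
    [IsProbabilityMeasure P] {Y : ℝ → Ω → ℝ} {p T ε δ : ℝ}
    (hmeas : AEMeasurable (fun q : ℝ × Ω => Y q.1 q.2)
      ((volume.restrict (Set.Icc 0 T)).prod P))
    (hY : ∀ t, HasGaussianLaw (Y t) P) (h0 : ∀ t, ∫ x, Y t x ∂P = 0)
    (hp : 0 < p) (hT : 0 < T) (hε : 0 < ε) (hδ : 0 < δ) (hδ₁ : δ < 1) {g : ℝ → ℝ}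
    (hg : Continuous g) (hgpos : ∀ t ∈ Set.Icc 0 T, 0 < g t)
    (hvar : ∀ t ∈ Set.Icc 0 T, ∫ x, Y t x ^ 2 ∂P ≤ g t ^ 2)
    (hS : ∫ t in (0 : ℝ)..T, g t ^ p <
      ε / max (p ^ (p / 2)) ((2 * Real.log (2 / δ)) ^ (p / 2))) :
    (∀ᵐ x ∂P, IntervalIntegrable (fun t => |Y t x| ^ p) volume 0 T) ∧
      P.real {x | ε < ∫ t in (0 : ℝ)..T, |Y t x| ^ p} ≤ δ := by
  set μ := volume.restrict (Set.Icc (0 : ℝ) T) with hμ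
  have hmem : ∀ᵐ t ∂μ, t ∈ Set.Icc 0 T := ae_restrict_mem measurableSet_Icc
  set S := ∫ t in (0 : ℝ)..T, g t ^ p with hSdef
  have hgp : ContinuousOn (fun t => g t ^ p) (Set.Icc 0 T) :=
    hg.continuousOn.rpow_const fun t ht => Or.inr hp.le
  have hSpos : 0 < S := by
    refine intervalIntegral.intervalIntegral_pos_of_pos_on ?_ ?_ hT
    · exact (hgp.mono (by rw [Set.uIcc_of_le hT.le])).intervalIntegrable
    · exact fun t ht => Real.rpow_pos_of_pos (hgpos t ⟨ht.1.le, ht.2.le⟩) p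
  have hSl : ∫⁻ t, ENNReal.ofReal (g t) ^ p ∂μ = ENNReal.ofReal S := by
    rw [hSdef, intervalIntegral.integral_of_le hT.le, ← integral_Icc_eq_integral_Ioc,
      ofReal_integral_eq_lintegral_ofReal hgp.integrableOn_Icc]
    · refine lintegral_congr_ae ?_
      filter_upwards [hmem] with t ht
      exact ENNReal.ofReal_rpow_of_nonneg (hgpos t ht).le hp.le
    · filter_upwards [hmem] with t ht
      exact (Real.rpow_pos_of_pos (hgpos t ht) p).le
  have hlog : 0 < 2 * Real.log (2 / δ) :=
    mul_pos two_pos (Real.log_pos (by rw [lt_div_iff₀ hδ]; linarith))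
  have hmax : max (p ^ (p / 2)) ((2 * Real.log (2 / δ)) ^ (p / 2)) < ε / S := by
    rw [lt_div_iff₀ (lt_max_of_lt_left (Real.rpow_pos_of_pos hp _))] at hS
    rwa [lt_div_iff₀ hSpos, mul_comm]
  set R := ε / S with hR
  have hRpos : 0 < R := div_pos hε hSpos
  -- Chosen so that s^(s/2) = (ε/S)^(s/p), which cancels the factor (S/ε)^(s/p) from Markov's
  -- inequality.
  set s := R ^ (2 / p) with hs
  have hlt : ∀ b : ℝ, 0 < b → b ^ (p / 2) < R → b < s := by
    intro b hb h
    have h1 := Real.rpow_lt_rpow (by positivity) h (by positivity : 0 < 2 / p)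
    rwa [← Real.rpow_mul hb.le, show p / 2 * (2 / p) = 1 by field_simp, Real.rpow_one] at h1
  have hps : p < s := hlt p hp ((le_max_left _ _).trans_lt hmax)
  have hls : 2 * Real.log (2 / δ) < s := hlt _ hlog ((le_max_right _ _).trans_lt hmax)
  have hs0 : 0 < s := hp.trans hps
  have hsqrt : √s ^ s = R ^ (s / p) := by
    rw [Real.sqrt_eq_rpow, hs, ← Real.rpow_mul hRpos.le, ← hs, ← Real.rpow_mul hRpos.le]
    congr 1; field_simp
  have hmom := lintegral_lintegral_enorm_rpow_rpow_le hmeas hY h0 hg.measurable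
    (by filter_upwards [hmem] with t ht using hgpos t ht)
    (by filter_upwards [hmem] with t ht using hvar t ht) hp hps
    (by rw [hSl]; simpa using hSpos) (by rw [hSl]; exact ENNReal.ofReal_ne_top)
  rw [hSl, hsqrt] at hmom
  set I : Ω → ENNReal := fun x => ∫⁻ t, ‖Y t x‖ₑ ^ p ∂μ with hI
  have hswap : AEMeasurable (fun q : Ω × ℝ => Y q.2 q.1) (P.prod μ) :=
    hmeas.aestronglyMeasurable.prod_swap.aemeasurable
  have hIm : AEMeasurable I P := (hswap.enorm.pow_const p).lintegral_prod_right'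
  have hsp : 0 < s / p := by positivity
  have hfin : ∀ᵐ x ∂P, I x < ⊤ := by
    have h1 : ∫⁻ x, I x ^ (s / p) ∂P ≠ ⊤ := by
      refine ne_top_of_le_ne_top ?_ hmom
      exact ENNReal.mul_ne_top ENNReal.ofReal_ne_top
        (ENNReal.rpow_ne_top_of_nonneg hsp.le ENNReal.ofReal_ne_top)
    filter_upwards [ae_lt_top' (hIm.pow_const _) h1] with x hx
    by_contra h
    rw [not_lt, top_le_iff] at h
    rw [h, ENNReal.top_rpow_of_pos hsp] at hx
    exact lt_irrefl _ hx
  have henorm : ∀ x t, ‖|Y t x| ^ p‖ₑ = ‖Y t x‖ₑ ^ p := by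
    intro x t
    rw [Real.enorm_of_nonneg (by positivity), Real.enorm_eq_ofReal_abs,
      ENNReal.ofReal_rpow_of_nonneg (abs_nonneg _) hp.le]
  constructor
  · filter_upwards [hfin, hswap.aestronglyMeasurable.prodMk_left] with x hx hxm
    rw [intervalIntegrable_iff_integrableOn_Icc_of_le hT.le]
    refine ⟨(hxm.aemeasurable.abs.pow_const p).aestronglyMeasurable, ?_⟩
    rw [HasFiniteIntegral]
    simpa only [henorm] using hx
  · have hsub : {x | ε < ∫ t in (0 : ℝ)..T, |Y t x| ^ p} ⊆
        {x | ENNReal.ofReal (ε ^ (s / p)) ≤ I x ^ (s / p)} := by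
      intro x hx
      rw [Set.mem_ofPred_eq, intervalIntegral.integral_of_le hT.le,
        ← integral_Icc_eq_integral_Ioc] at hx
      have h1 := enorm_integral_le_lintegral_enorm (μ := μ) (fun t => |Y t x| ^ p)
      simp only [henorm] at h1
      rw [Set.mem_ofPred_eq, ← ENNReal.ofReal_rpow_of_pos hε]
      refine ENNReal.rpow_le_rpow (le_trans ?_ h1) hsp.le
      rw [Real.enorm_of_nonneg (hε.le.trans hx.le)]
      exact ENNReal.ofReal_le_ofReal hx.le
    have hεq : 0 < ε ^ (s / p) := Real.rpow_pos_of_pos hε _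
    have hfinal : P {x | ε < ∫ t in (0 : ℝ)..T, |Y t x| ^ p} ≤ ENNReal.ofReal δ := by
      refine (measure_mono hsub).trans ((meas_ge_le_lintegral_div (hIm.pow_const _)
        (by simpa using hεq) ENNReal.ofReal_ne_top).trans ?_)
      refine ENNReal.div_le_of_le_mul (hmom.trans ?_)
      rw [ENNReal.ofReal_rpow_of_pos hSpos, ← ENNReal.ofReal_mul (by positivity),
        ← ENNReal.ofReal_mul hδ.le]
      refine ENNReal.ofReal_le_ofReal ?_
      have h2 : R ^ (s / p) * S ^ (s / p) = ε ^ (s / p) := by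
        rw [← Real.mul_rpow hRpos.le hSpos.le, hR, div_mul_cancel₀ _ hSpos.ne']
      rw [mul_assoc, h2]
      refine mul_le_mul_of_nonneg_right ?_ hεq.le
      have h3 : Real.exp (-s / 2) ≤ Real.exp (-Real.log (2 / δ)) :=
        Real.exp_le_exp.2 (by linarith)
      rw [Real.exp_neg, Real.exp_log (by positivity), inv_div] at h3
      linarith
    rw [Measure.real]
    exact ENNReal.toReal_le_of_le_ofReal hδ.le hfinal

/-! ### Mean square error through the spectral measure -/

namespace WKS.IsBandlimitedStationary

variable {Ω : Type*} [MeasurableSpace Ω] {P : Measure Ω} {X : ℝ → Ω → ℝ} {L : ℝ}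

/-- The mean square of a linear combination of values of the process is bounded by the supremum
of the corresponding trigonometric polynomial over the band. -/
lemma integral_sq_sum_le (h : WKS.IsBandlimitedStationary P X L) {ι : Type*} (I : Finset ι)
    (a τ : ι → ℝ) {K : ℝ} (hK : ∀ l ∈ Set.Ico (-L) L,
      ‖∑ i ∈ I, (a i : ℂ) * Complex.exp (Complex.I * τ i * l)‖ ≤ K) :
    ∫ x, (∑ i ∈ I, a i * X (τ i) x) ^ 2 ∂P ≤ WKS.covFun P X 0 * K ^ 2 := by
  obtain ⟨F, hF, -, hcov⟩ := h.spectrum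
  set ν := F.restrict (Set.Ico (-L) L) with hν
  have hcov0 : WKS.covFun P X 0 = ν.real Set.univ := by
    have h0 := hcov 0 0
    simp only [Complex.ofReal_zero, mul_zero, zero_mul, Complex.exp_zero] at h0
    rw [integral_const] at h0
    have h1 : ((WKS.covFun P X 0 : ℝ) : ℂ) = (ν.real Set.univ : ℝ) := by
      rw [WKS.covFun, h0]; simp
    exact_mod_cast h1
  have hXX : ∀ i j, Integrable (fun x => X (τ i) x * X (τ j) x) P := fun i j =>
    (h.memLp_two (τ i)).integrable_mul (h.memLp_two (τ j))
  have hexp : ∀ c : ℝ, Integrable (fun l : ℝ => Complex.exp (Complex.I * (c : ℂ) * (l : ℂ))) ν := by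
    intro c
    refine Integrable.of_bound (by fun_prop) 1 (Filter.Eventually.of_forall fun l => ?_)
    simp [Complex.norm_exp]
  have hleft : ∫ x, (∑ i ∈ I, a i * X (τ i) x) ^ 2 ∂P =
      ∑ i ∈ I, ∑ j ∈ I, a i * a j * ∫ x, X (τ i) x * X (τ j) x ∂P := by
    have e : ∀ x, (∑ i ∈ I, a i * X (τ i) x) ^ 2 =
        ∑ i ∈ I, ∑ j ∈ I, a i * a j * (X (τ i) x * X (τ j) x) := by
      intro x
      rw [sq, Finset.sum_mul_sum]
      exact Finset.sum_congr rfl fun i _ => Finset.sum_congr rfl fun j _ => by ring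
    simp_rw [e]
    rw [integral_finsetSum _ fun i _ => integrable_finsetSum _ fun j _ => (hXX i j).const_mul _]
    refine Finset.sum_congr rfl fun i _ => ?_
    rw [integral_finsetSum _ fun j _ => (hXX i j).const_mul _]
    exact Finset.sum_congr rfl fun j _ => integral_const_mul _ _
  set φ : ℝ → ℂ := fun l => ∑ i ∈ I, (a i : ℂ) * Complex.exp (Complex.I * τ i * l) with hφ
  -- Expanding |φ|² gives the exponentials exp(i(τ_i - τ_j)l), whose integrals are covariances: the
  -- map X(τ) ↦ exp(iτ·) is an isometry into L² of the spectral measure.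
  have hright : ((∫ l, ‖φ l‖ ^ 2 ∂ν : ℝ) : ℂ) =
      ∑ i ∈ I, ∑ j ∈ I, (a i : ℂ) * a j * ((∫ x, X (τ i) x * X (τ j) x ∂P : ℝ) : ℂ) := by
    have e : ∀ l : ℝ, ((‖φ l‖ ^ 2 : ℝ) : ℂ) = ∑ i ∈ I, ∑ j ∈ I,
        (a i : ℂ) * a j * Complex.exp (Complex.I * ((τ i - τ j : ℝ) : ℂ) * (l : ℂ)) := by
      intro l
      push_cast
      rw [← Complex.mul_conj', hφ]
      simp only
      rw [map_sum, Finset.sum_mul_sum]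
      refine Finset.sum_congr rfl fun i _ => Finset.sum_congr rfl fun j _ => ?_
      rw [map_mul, Complex.conj_ofReal, ← Complex.exp_conj, map_mul, map_mul, Complex.conj_I,
        Complex.conj_ofReal, Complex.conj_ofReal]
      rw [mul_mul_mul_comm, ← Complex.exp_add]
      congr 2
      ring
    rw [← integral_complex_ofReal]
    simp_rw [e]
    rw [integral_finsetSum _ fun i _ => integrable_finsetSum _ fun j _ => (hexp _).const_mul _]
    refine Finset.sum_congr rfl fun i _ => ?_
    rw [integral_finsetSum _ fun j _ => (hexp _).const_mul _]
    refine Finset.sum_congr rfl fun j _ => ?_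
    rw [integral_const_mul, ← hcov (τ j) (τ i - τ j), add_sub_cancel]
  have hEq : ∫ x, (∑ i ∈ I, a i * X (τ i) x) ^ 2 ∂P = ∫ l, ‖φ l‖ ^ 2 ∂ν := by
    have : ((∫ x, (∑ i ∈ I, a i * X (τ i) x) ^ 2 ∂P : ℝ) : ℂ) = (∫ l, ‖φ l‖ ^ 2 ∂ν : ℝ) := by
      rw [hright, hleft]; push_cast; rfl
    exact_mod_cast this
  rw [hEq, hcov0, ← smul_eq_mul, ← integral_const]
  have hb : ∀ᵐ l ∂ν, ‖φ l‖ ^ 2 ≤ K ^ 2 := by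
    filter_upwards [ae_restrict_mem measurableSet_Ico] with l hl
    exact pow_le_pow_left₀ (norm_nonneg _) (hK l hl) 2
  exact integral_mono_of_nonneg (Filter.Eventually.of_forall fun l => sq_nonneg _)
    (integrable_const _) hb

/-- Mean square error of the truncated sampling expansion. -/
lemma integral_sq_sub_truncSum_le (h : WKS.IsBandlimitedStationary P X L) {ω z T t : ℝ} {n : ℕ}
    (hL : 0 < L) (hω : L < ω) (hz₀ : 0 < z) (hz₁ : z < 1) (hn₀ : 0 < n)
    (hn : ω * T / (Real.pi * √z) ≤ n) (ht : t ∈ Set.Icc 0 T) :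
    ∫ x, (X t x - WKS.truncSum X ω n t x) ^ 2 ∂P ≤
      WKS.Cn (WKS.covFun P X 0) ω L z n t / n ^ 2 := by
  have hpi := Real.pi_pos
  have hω0 : 0 < ω := hL.trans hω
  have hr : L / ω < 1 := (div_lt_one hω0).2 hω
  have hr₀ : 0 < L / ω := div_pos hL hω0
  have hn' : (0 : ℝ) < n := by exact_mod_cast hn₀
  have hz' : 0 < 1 - z := by linarith
  have hr' : 0 < 1 - L / ω := by linarith
  have hsz : 0 < √z := Real.sqrt_pos.2 hz₀
  set u := ω * t / Real.pi with hu
  have hu0 : 0 ≤ u := div_nonneg (mul_nonneg hω0.le ht.1) hpi.le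
  have hun : u ^ 2 ≤ n ^ 2 * z := by
    have h1 : u ≤ n * √z := by
      rw [div_le_iff₀ (by positivity)] at hn
      rw [hu, div_le_iff₀ hpi]
      nlinarith [mul_le_mul_of_nonneg_left ht.2 hω0.le]
    calc u ^ 2 ≤ (n * √z) ^ 2 := pow_le_pow_left₀ hu0 h1 2
      _ = _ := by rw [mul_pow, Real.sq_sqrt hz₀.le]
  set K := (2 * u / (Real.pi * (1 - z)) + 2 / (Real.pi * (1 - z) * (1 - L / ω))) / n with hK
  -- The index `none` stands for X(t) itself, and `some k` for the sample at kπ/ω.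
  set a : Option ℤ → ℝ := fun o => o.elim 1
    fun k => -Real.sinc (ω * (t - (k : ℝ) * Real.pi / ω)) with ha
  set τ : Option ℤ → ℝ := fun o => o.elim t fun k => (k : ℝ) * Real.pi / ω with hτ
  have hmain := h.integral_sq_sum_le (Finset.insertNone (Finset.Icc (-(n : ℤ)) n)) a τ (K := K) (by
    intro l hl
    have hθ : |Real.pi * l / ω| ≤ Real.pi * (L / ω) := by
      have : |l| ≤ L := abs_le.2 ⟨hl.1, hl.2.le⟩
      rw [abs_div, abs_mul, abs_of_pos hpi, abs_of_pos hω0, mul_div_assoc]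
      gcongr
    refine le_of_eq_of_le ?_ (norm_exp_sub_sampledExp_le hn₀ hz₁ hu0 hun hr₀ hr hθ)
    congr 1
    have hωc : (ω : ℂ) ≠ 0 := by exact_mod_cast hω0.ne'
    have hpc : (Real.pi : ℂ) ≠ 0 := by exact_mod_cast hpi.ne'
    rw [Finset.sum_insertNone, sampledExp, sub_eq_add_neg, ← Finset.sum_neg_distrib]
    simp only [ha, hτ, Option.elim]
    congr 1
    · rw [Complex.ofReal_one, one_mul]
      congr 1
      rw [hu]; push_cast; field_simp
    · refine Finset.sum_congr rfl fun k _ => ?_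
      rw [Complex.ofReal_neg, neg_mul]
      have e : ω * (t - (k : ℝ) * Real.pi / ω) = Real.pi * (u - k) := by
        rw [hu]; field_simp
      rw [e]
      congr 3
      push_cast; field_simp)
  have hlhs : ∀ x, X t x - WKS.truncSum X ω n t x =
      ∑ o ∈ Finset.insertNone (Finset.Icc (-(n : ℤ)) n), a o * X (τ o) x := by
    intro x
    rw [Finset.sum_insertNone, WKS.truncSum, sub_eq_add_neg, ← Finset.sum_neg_distrib]
    simp only [ha, hτ, Option.elim, one_mul, neg_mul]
  simp_rw [hlhs]
  refine hmain.trans ?_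
  have hb : 0 ≤ WKS.covFun P X 0 := by
    rw [WKS.covFun]
    exact integral_nonneg fun x => by rw [add_zero]; exact mul_self_nonneg _
  -- The constant obtained above is sharper than the one in `Cn`: 2 ≤ 4, 1 ≤ z + 1 + 1/n and (1 -
  -- z)² ≤ 1 - z.
  have hle : 2 * u / (Real.pi * (1 - z)) + 2 / (Real.pi * (1 - z) * (1 - L / ω)) ≤
      4 * ω * t / (Real.pi ^ 2 * (1 - z)) +
        4 * (z + 1 + 1 / (n : ℝ)) / (Real.pi * (1 - z) ^ 2 * (1 - L / ω)) := by
    have hωt : 0 ≤ ω * t := mul_nonneg hω0.le ht.1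
    refine add_le_add ?_ ?_
    · have : 2 * u / (Real.pi * (1 - z)) = 2 * (ω * t) / (Real.pi ^ 2 * (1 - z)) := by
        rw [hu]; field_simp
      rw [this, mul_assoc]
      gcongr
      norm_num
    · have h1 : (1 : ℝ) ≤ z + 1 + 1 / n := by
        have : (0 : ℝ) < 1 / n := by positivity
        linarith
      have h2 : (1 - z) ^ 2 ≤ 1 - z := by nlinarith
      refine div_le_div₀ (by positivity) (by linarith) (by positivity) ?_
      gcongr
  rw [WKS.Cn, mul_div_assoc, ← div_pow, hK]
  gcongr

end WKS.IsBandlimitedStationary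

/-! ### Assembling the theorem -/

lemma ProbabilityTheory.IsGaussianProcess.hasGaussianLaw_sum_mul {Ω T : Type*} [MeasurableSpace Ω]
    {P : Measure Ω} {X : T → Ω → ℝ} (hX : IsGaussianProcess X P) {ι : Type*} (I : Finset ι)
    (a : ι → ℝ) (τ : ι → T) : HasGaussianLaw (fun x => ∑ i ∈ I, a i * X (τ i) x) P :=
  ((hX.comp_right τ).smul a).hasGaussianLaw_fun_sum

theorem corollary2 {Ω : Type*} [MeasurableSpace Ω] (P : Measure Ω) [IsProbabilityMeasure P]
    (X : ℝ → Ω → ℝ) (L ω z p T ε δ : ℝ) (n : ℕ)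
    (hL : 0 < L) (hω : L < ω) (hz₀ : 0 < z) (hz₁ : z < 1) (hp : 1 ≤ p) (hT : 0 < T)
    (hε : 0 < ε) (hδ₀ : 0 < δ) (hδ₁ : δ < 1)
    (hX : IsGaussianProcess X P)
    (hband : WKS.IsBandlimitedStationary P X L)
    (hmeas : AEMeasurable (fun q : ℝ × Ω => X q.1 q.2)
      ((volume.restrict (Set.Icc 0 T)).prod P))
    (hn : ω * T / (Real.pi * √z) ≤ (n : ℝ))
    (hS : WKS.Shat (WKS.covFun P X 0) ω L z n p T <
      ε / max (p ^ (p / 2)) ((2 * Real.log (2 / δ)) ^ (p / 2))) :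
    WKS.ApproximatesLp P X (WKS.truncSum X ω n) p T ε δ := by
  have hpi := Real.pi_pos
  have hω0 : 0 < ω := hL.trans hω
  have hp0 : 0 < p := by linarith
  have hn' : (0 : ℝ) < n := lt_of_lt_of_le (by positivity) hn
  have hn₀ : 0 < n := by exact_mod_cast hn'
  have hz' : 0 < 1 - z := by linarith
  have hr' : 0 < 1 - L / ω := sub_pos.2 ((div_lt_one hω0).2 hω)
  set Y : ℝ → Ω → ℝ := fun t x => X t x - WKS.truncSum X ω n t x with hY
  have hYm : AEMeasurable (fun q : ℝ × Ω => Y q.1 q.2)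
      ((volume.restrict (Set.Icc 0 T)).prod P) := by
    refine hmeas.sub (Finset.aemeasurable_fun_sum _ fun k _ => AEMeasurable.mul ?_ ?_)
    · exact (Real.continuous_sinc.measurable.comp (by fun_prop :
        Measurable fun q : ℝ × Ω => ω * (q.1 - (k : ℝ) * Real.pi / ω))).aemeasurable
    · exact (hX.aemeasurable _).comp_snd
  have hYsum : ∀ t x, Y t x = ∑ o ∈ Finset.insertNone (Finset.Icc (-(n : ℤ)) n),
      (o.elim 1 fun k => -Real.sinc (ω * (t - (k : ℝ) * Real.pi / ω)) : ℝ) *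
        X (o.elim t fun k => (k : ℝ) * Real.pi / ω) x := by
    intro t x
    rw [Finset.sum_insertNone]
    simp only [hY, WKS.truncSum, sub_eq_add_neg, Option.elim, one_mul, neg_mul,
      Finset.sum_neg_distrib]
  have hYg : ∀ t, HasGaussianLaw (Y t) P := by
    intro t
    rw [funext (hYsum t)]
    exact hX.hasGaussianLaw_sum_mul _ _ _
  have hY0 : ∀ t, ∫ x, Y t x ∂P = 0 := by
    intro t
    simp_rw [hYsum]
    rw [integral_finsetSum _ fun o _ =>
      ((hband.memLp_two _).integrable one_le_two).const_mul _]
    refine Finset.sum_eq_zero fun o _ => ?_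
    rw [integral_const_mul, hband.mean_zero, mul_zero]
  set b := WKS.covFun P X 0 with hb
  have hb0 : 0 ≤ b := by
    rw [hb, WKS.covFun]
    exact integral_nonneg fun x => by rw [add_zero]; exact mul_self_nonneg _
  have hvar : ∀ t ∈ Set.Icc 0 T, ∫ x, Y t x ^ 2 ∂P ≤ WKS.Cn b ω L z n t / n ^ 2 :=
    fun t ht => hband.integral_sq_sub_truncSum_le hL hω hz₀ hz₁ hn₀ hn ht
  rcases hb0.eq_or_lt with hbz | hbpos
  -- When B(0) = 0 the function `Cn` vanishes, while the tail bound needs g > 0. Any positive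
  -- constant dominates the zero variance; this one makes ∫ g^p half of the allowed value.
  · set M := max (p ^ (p / 2)) ((2 * Real.log (2 / δ)) ^ (p / 2)) with hM
    have hMpos : 0 < M := lt_max_of_lt_left (Real.rpow_pos_of_pos hp0 _)
    have hc : 0 < ε / (2 * T * M) := by positivity
    refine measureReal_lt_integral_abs_rpow_le (g := fun _ => (ε / (2 * T * M)) ^ (1 / p))
      hYm hYg hY0 hp0 hT hε hδ₀ hδ₁ continuous_const (fun t _ => by positivity)
      (fun t ht => (hvar t ht).trans ?_) ?_
    · rw [WKS.Cn, ← hbz, zero_mul, zero_div]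
      exact sq_nonneg _
    · rw [intervalIntegral.integral_const, ← Real.rpow_mul hc.le, one_div_mul_cancel hp0.ne',
        Real.rpow_one, smul_eq_mul, sub_zero, ← hM]
      have : T * (ε / (2 * T * M)) = ε / M / 2 := by field_simp
      rw [this]
      exact half_lt_self (by positivity)
  · set l : ℝ → ℝ := fun t => 4 * ω * t / (Real.pi ^ 2 * (1 - z)) +
      4 * (z + 1 + 1 / (n : ℝ)) / (Real.pi * (1 - z) ^ 2 * (1 - L / ω)) with hl
    have hlpos : ∀ t ∈ Set.Icc 0 T, 0 < l t := by
      intro t ht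
      have ht0 := ht.1
      simp only [hl]
      positivity
    have hlc : Continuous l := by fun_prop
    -- Here g = √C_n / n, so that ∫ g^p is exactly `Shat`.
    refine measureReal_lt_integral_abs_rpow_le (g := fun t => √b * l t / n)
      hYm hYg hY0 hp0 hT hε hδ₀ hδ₁ (by fun_prop)
      (fun t ht => div_pos (mul_pos (Real.sqrt_pos.2 hbpos) (hlpos t ht)) hn')
      (fun t ht => (hvar t ht).trans_eq ?_) (lt_of_eq_of_lt ?_ hS)
    · rw [div_pow, mul_pow, Real.sq_sqrt hb0, WKS.Cn]
    · rw [WKS.Shat, ← intervalIntegral.integral_const_mul]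
      refine intervalIntegral.integral_congr fun t ht => ?_
      rw [Set.uIcc_of_le hT.le] at ht
      have h1 : WKS.Cn b ω L z n t = (√b * l t) ^ 2 := by
        rw [mul_pow, Real.sq_sqrt hb0, WKS.Cn]
      have h2 : 0 ≤ √b * l t := mul_nonneg (Real.sqrt_nonneg _) (hlpos t ht).le
      rw [h1, Real.div_rpow h2 hn'.le, Real.rpow_neg hn'.le, ← Real.rpow_natCast _ 2,
        ← Real.rpow_mul h2, Nat.cast_ofNat, mul_div_cancel₀ p two_ne_zero, inv_mul_eq_div]
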